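/- Let $d\ge 1$, $I_d=\{1,\dots,d\}$, let $\mathcal S^d=\{\theta\in\mathbb R^d:\theta^i\ge 0,\ \sum_i\theta^i=1\}$ be the probability simplex, and let $c:I_d\times\mathcal S^d\times(\mathbb R_0^+)^d\to\mathbb R$, $c(i,\theta,\alpha)$, be a running cost such that: - $c$ is Lipschitz in $\theta$ uniformly in $\alpha$; $c$ is differentiable in $\alpha$ on the closed orthant $(\mathbb R_0^+)^d$ (derivatives taken within the orthant); and $\nabla_\alpha c$ is Lipschitz in $\theta$ uniformly in $\alpha$; - $c(i,\theta,\alpha)$ does not depend on $\alpha_i$, and it is uniformly convex in the remaining coordinates: there is $\gamma>0$ with $c(i,\theta,\alpha')-c(i,\theta,\alpha)\ge\nabla_\alpha c(i,\theta,\alpha)\cdot(\alpha'-\alpha)+\gamma\sum_{j\ne i}(\alpha'_j-\alpha_j)^2$ for all $i,\theta,\alpha,\alpha'$; - for $j\neq i$, $c(i,\theta,\alpha)/\|\alpha\|\to\infty$ as $\alpha_j\to\infty$ with the other coordinates of $\alpha$ fixed. For $z\in\mathbb R^d$ put $\Delta_i z=(z^1-z^i,\dots,z^d-z^i)$ and $$h(z,\theta,i)=\min_{\mu\in(\mathbb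 R_0^+)^d}\big(c(i,\theta,\mu)+\mu\cdot\Delta_i z\big).$$ For $j\ne i$ let $\alpha^*_j(z,\theta,i)$ be the $j$-th coordinate (which is unique) of a minimizer, and put $\alpha_i^*(z,\theta,i)=-\sum_{j\ne i}\alpha_j^*(z,\theta,i)$. Let $\|v\|=\max_i|v^i|$, $\mathbf 1=(1,\dots,1)$ and $\|v\|_\sharp=\inf_{\lambda\in\mathbb R}\|v+\lambda\mathbf 1\|$. Consider the mean field game equations $$\frac{d\theta^i}{dt}=\sum_j\theta^j\,\alpha_i^*(\Delta_j u,\theta,j),\qquad -\frac{du^i}{dt}=h(\Delta_i u,\theta,i),\qquad i\in I_d, \tag{1}$$ whose solutions are trajectories $(u,\theta)$ with values in the phase space $\mathbb R^d\times\mathcal S^d$. Suppose that $h$ is contractive: there is $M>0$ such that for all $\theta\in\mathcal S^d$, all $i$, and all $u$ with $\|u\|_\sharp>M$, $$(\Delta_iu)^j\le0\ \ \forall j\ \Longrightarrow\ h(\Delta_iu,\theta,i)<\frac1d\sum_k h(u,\theta,k),\qquad (\Delta_iu)^j\ge0\ \ \forall j\ \Longrightarrow\ h(\Delta_iu,\theta,i)>\frac1d\sum_k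 h(u,\theta,k).$$ Then: (a) For all sufficiently large $M$, the set $A_M=\{u\in\mathbb R^d:\|u\|_\sharp<M\}\times\mathcal S^d$ is invariant backwards in time under (1): if $(u,\theta):[a,b]\to\mathbb R^d\times\mathcal S^d$ solves (1) and $(u(b),\theta(b))\in A_M$, then $(u(t),\theta(t))\in A_M$ for all $t\in[a,b]$. The threshold for $M$ depends only on $c$. (b) There is a stationary solution of (1), that is, a triple $(\bar\theta,\bar u,\kappa)\in\mathcal S^d\times\mathbb R^d\times\mathbb R$ with $$\sum_j\bar\theta^j\alpha_i^*(\Delta_j\bar u,\bar\theta,j)=0\quad\text{and}\quad h(\Delta_i\bar u,\bar\theta,i)=\kappa\qquad\text{for all } i\in I_d.$$ -/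

import Mathlib

open Set Filter Topology

noncomputable section

namespace MeanFieldGame

variable {d : ℕ}

/-- The admissible vectors of switching rates, `(ℝ₀⁺)^d`. -/
def orthant (d : ℕ) : Set (Fin d → ℝ) := {μ | ∀ j, 0 ≤ μ j}

/-- The difference operator `Δ_i z = (z^1 - z^i, …, z^d - z^i)`. -/
def diffOp (i : Fin d) (z : Fin d → ℝ) : Fin d → ℝ := fun j => z j - z i

/-- The norm `‖v‖_♯ = inf_l ‖v + l 𝟏‖` on `ℝ^d / ℝ`, where `‖·‖` is the maximum norm
(the norm that Mathlib puts on `Fin d → ℝ`). -/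
def sharpNorm (v : Fin d → ℝ) : ℝ := ⨅ l : ℝ, ‖v + fun _ => l‖

/-- The standing assumptions on a running cost `c : I_d × S^d × (ℝ₀⁺)^d → ℝ`.
The function is written on all of `ℝ^d × ℝ^d`, but only its values for `θ` in the simplex and `α` in
the closed orthant are ever used; derivatives in `α` are taken within the orthant. -/
structure IsRunningCost (c : Fin d → (Fin d → ℝ) → (Fin d → ℝ) → ℝ) : Prop where
  /-- `c` is Lipschitz in `θ`, uniformly in `α`. -/
  lipschitz : ∃ K : ℝ, ∀ i, ∀ θ ∈ stdSimplex ℝ (Fin d), ∀ θ' ∈ stdSimplex ℝ (Fin d),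
    ∀ α ∈ orthant d, |c i θ α - c i θ' α| ≤ K * ‖θ - θ'‖
  /-- `c` is differentiable in `α`. -/
  differentiable : ∀ i, ∀ θ ∈ stdSimplex ℝ (Fin d), DifferentiableOn ℝ (c i θ) (orthant d)
  /-- `∂c/∂α` is Lipschitz in `θ`, uniformly in `α`. -/
  lipschitz_deriv : ∃ K : ℝ, ∀ i, ∀ θ ∈ stdSimplex ℝ (Fin d), ∀ θ' ∈ stdSimplex ℝ (Fin d),
    ∀ α ∈ orthant d,
      ‖fderivWithin ℝ (c i θ) (orthant d) α - fderivWithin ℝ (c i θ') (orthant d) α‖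
        ≤ K * ‖θ - θ'‖
  /-- `c i θ α` does not depend on the coordinate `α_i`. -/
  indep : ∀ i, ∀ θ ∈ stdSimplex ℝ (Fin d), ∀ α ∈ orthant d, ∀ α' ∈ orthant d,
    (∀ j, j ≠ i → α j = α' j) → c i θ α = c i θ α'
  /-- `c` is uniformly convex in the coordinates `α_j`, `j ≠ i`. -/
  uniform_convex : ∃ γ : ℝ, 0 < γ ∧ ∀ i, ∀ θ ∈ stdSimplex ℝ (Fin d),
    ∀ α ∈ orthant d, ∀ α' ∈ orthant d,
      fderivWithin ℝ (c i θ) (orthant d) α (α' - α)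
          + γ * ∑ j ∈ Finset.univ.erase i, (α' j - α j) ^ 2
        ≤ c i θ α' - c i θ α
  /-- `c` is superlinear in each `α_j`, `j ≠ i`. -/
  superlinear : ∀ i, ∀ θ ∈ stdSimplex ℝ (Fin d), ∀ α ∈ orthant d, ∀ j, j ≠ i →
    Tendsto (fun s : ℝ => c i θ (Function.update α j s) / ‖Function.update α j s‖) atTop atTop

/-- The function `μ ↦ c(i,θ,μ) + μ · Δ_i z` that is minimized over the orthant. -/
def hamiltonianCost (c : Fin d → (Fin d → ℝ) → (Fin d → ℝ) → ℝ) (z θ : Fin d → ℝ) (i : Fin d)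
    (μ : Fin d → ℝ) : ℝ :=
  c i θ μ + ∑ j, μ j * diffOp i z j

/-- The generalized Legendre transform `h(z,θ,i) = min_{μ ∈ (ℝ₀⁺)^d} c(i,θ,μ) + μ · Δ_i z`.
(For a running cost the infimum is attained.) -/
def h (c : Fin d → (Fin d → ℝ) → (Fin d → ℝ) → ℝ) (z θ : Fin d → ℝ) (i : Fin d) : ℝ :=
  sInf (hamiltonianCost c z θ i '' orthant d)

open Classical in
/-- A minimizer over the orthant of `μ ↦ c(i,θ,μ) + μ · Δ_i z`. For a running cost a minimizer
exists, and its coordinates other than the `i`-th are unique; the value `0` is never used then. -/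
def argminRate (c : Fin d → (Fin d → ℝ) → (Fin d → ℝ) → ℝ) (z θ : Fin d → ℝ) (i : Fin d) :
    Fin d → ℝ :=
  if H : ∃ μ ∈ orthant d, IsMinOn (hamiltonianCost c z θ i) (orthant d) μ then H.choose else 0

/-- The optimal rates: `αStar c z θ i j` is `α*_j(z,θ,i)`, the minimizer for `j ≠ i`, and
`α*_i(z,θ,i) = - ∑_{k ≠ i} α*_k(z,θ,i)`. -/
def αStar (c : Fin d → (Fin d → ℝ) → (Fin d → ℝ) → ℝ) (z θ : Fin d → ℝ) (i j : Fin d) : ℝ :=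
  if j = i then - ∑ k ∈ Finset.univ.erase i, argminRate c z θ i k else argminRate c z θ i j

/-- `h` is contractive; `⟨h(u,θ,·)⟩` is the average over the `d` states. -/
def IsContractive (c : Fin d → (Fin d → ℝ) → (Fin d → ℝ) → ℝ) : Prop :=
  ∃ M : ℝ, 0 < M ∧ ∀ θ ∈ stdSimplex ℝ (Fin d), ∀ (i : Fin d) (u : Fin d → ℝ), M < sharpNorm u →
    ((∀ j, diffOp i u j ≤ 0) → h c (diffOp i u) θ i - (1 / (d : ℝ)) * ∑ j, h c u θ j < 0) ∧
    ((∀ j, 0 ≤ diffOp i u j) → 0 < h c (diffOp i u) θ i - (1 / (d : ℝ)) * ∑ j, h c u θ j)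

/-- `(θ, u) : [a, b] → S^d × ℝ^d` is a solution of the mean field game equations
`dθ^i/dt = ∑_j θ^j α*_i(Δ_j u, θ, j)`, `- du^i/dt = h(Δ_i u, θ, i)`.
The equations only make sense for `θ(t) ∈ S^d`, so the phase space is `ℝ^d × S^d`. -/
structure IsSolution (c : Fin d → (Fin d → ℝ) → (Fin d → ℝ) → ℝ) (a b : ℝ)
    (θ u : ℝ → Fin d → ℝ) : Prop where
  mem_simplex : ∀ t ∈ Icc a b, θ t ∈ stdSimplex ℝ (Fin d)
  kolmogorov : ∀ t ∈ Icc a b, ∀ i, HasDerivWithinAt (fun s => θ s i)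
    (∑ j, θ t j * αStar c (diffOp j (u t)) (θ t) j i) (Icc a b) t
  hamiltonJacobi : ∀ t ∈ Icc a b, ∀ i, HasDerivWithinAt (fun s => u s i)
    (- h c (diffOp i (u t)) (θ t) i) (Icc a b) t

/-- A subset `A` of the phase space is invariant backwards in time: a trajectory that lies in `A`
at some time lies in `A` at all earlier times at which it is defined. -/
def IsBackwardInvariant (c : Fin d → (Fin d → ℝ) → (Fin d → ℝ) → ℝ)
    (A : Set ((Fin d → ℝ) × (Fin d → ℝ))) : Prop :=
  ∀ (a b : ℝ) (θ u : ℝ → Fin d → ℝ), a ≤ b → IsSolution c a b θ u →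
    (u b, θ b) ∈ A → ∀ t ∈ Icc a b, (u t, θ t) ∈ A

/-- `(θ, u, κ) ∈ S^d × ℝ^d × ℝ` is a stationary solution of the mean field game equations. -/
structure IsStationarySolution (c : Fin d → (Fin d → ℝ) → (Fin d → ℝ) → ℝ)
    (θ u : Fin d → ℝ) (κ : ℝ) : Prop where
  mem_simplex : θ ∈ stdSimplex ℝ (Fin d)
  kolmogorov : ∀ i, ∑ j, θ j * αStar c (diffOp j u) θ j i = 0
  hamiltonJacobi : ∀ i, h c (diffOp i u) θ i = κ

end MeanFieldGame

end

/-!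
Both parts look at the oscillation of `u`, which is `2 * sharpNorm u`. When it is large,
contractivity makes the Hamiltonian smaller at a maximum of `u` than at a minimum, so along a
trajectory the oscillation increases in time; hence it cannot have been large at an earlier time if
it is small at a later one.

For a stationary solution write `u = R • s` with `s` in the simplex, and take an equilibrium
`(s, θ)` for the payoffs `h (R • s) θ` against `s` and the inflows of mass against `θ`. The
Hamiltonian is then maximal on the support of `s`. If it were not constant, some `s j` would vanish,
the oscillation of `u` would be at least `R / d`, and a maximum of `u`, which lies in the support,
would contradict contractivity. Similarly the inflow is maximal on the support of `θ`; it is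
nonnegative off the support and sums to zero, so it vanishes.

The equilibrium exists by the Gale–Nikaido–Debreu lemma on the simplex over the product of the index
sets, since the gains of deviating satisfy Walras' law. That lemma follows from a
Knaster–Kuratowski–Mazurkiewicz theorem, which Scarf's parity argument proves on the lattice points
of finer and finer grids. The payoffs are continuous because the optimal rates are: the convexity of
the cost makes it grow quadratically away from its minimizer.
-/

section Counting

variable {α β : Type*} [DecidableEq α] [DecidableEq β]

theorem image_erase_eq_iff {A : Finset α} {f : α → β} {a : α} (ha : a ∈ A) :
    (A.erase a).image f = A.image f ↔ ∃ b ∈ A, b ≠ a ∧ f b = f a := by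
  conv_lhs => rhs; rw [← Finset.insert_erase ha, Finset.image_insert]
  rw [eq_comm, Finset.insert_eq_self, Finset.mem_image]
  simp only [Finset.mem_erase]
  tauto

theorem card_filter_image_erase_eq {A : Finset α} {f : α → β}
    (hA : A.card = (A.image f).card + 1) :
    {a ∈ A | (A.erase a).image f = A.image f}.card = 2 := by
  obtain ⟨a, ha, b, hb, hab, hfab⟩ : ∃ a ∈ A, ∃ b ∈ A, a ≠ b ∧ f a = f b :=
    Finset.exists_ne_map_eq_of_card_lt_of_maps_to (by omega)
      fun _ hx => Finset.mem_image_of_mem f hx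
  have injOn_erase {x} (hx : x ∈ A) (h : (A.erase x).image f = A.image f) :
      Set.InjOn f (A.erase x) := by
    rw [← Finset.card_image_iff, h, Finset.card_erase_of_mem hx]
    omega
  have hfa := (image_erase_eq_iff ha).2 ⟨b, hb, hab.symm, hfab.symm⟩
  have hfb := (image_erase_eq_iff hb).2 ⟨a, ha, hab, hfab⟩
  suffices {x ∈ A | (A.erase x).image f = A.image f} = {a, b} by
    rw [this, Finset.card_pair hab]
  ext x
  simp only [Finset.mem_filter, Finset.mem_insert, Finset.mem_singleton]
  refine ⟨fun ⟨hx, hfx⟩ => ?_, by rintro (rfl | rfl) <;> exact ⟨‹_›, ‹_›⟩⟩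
  obtain ⟨y, hy, hyx, hfyx⟩ := (image_erase_eq_iff hx).1 hfx
  by_contra! hne
  by_cases hya : y = a
  · exact hyx (injOn_erase hb hfb (by simp [hya, hab, ha]) (by simp [hx, hne.2]) hfyx)
  · exact hyx (injOn_erase ha hfa (by simp [hy, hya]) (by simp [hx, hne.1]) hfyx)

theorem even_card_filter_image_erase_eq [Fintype β] {A : Finset α} {f : α → β}
    (hA : A.card = Fintype.card β) (hf : A.image f ≠ Finset.univ) (b : β) :
    Even {a ∈ A | (A.erase a).image f = Finset.univ.erase b}.card := by
  rcases Finset.eq_empty_or_nonempty {a ∈ A | (A.erase a).image f = Finset.univ.erase b}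
    with h | ⟨a, ha⟩
  · rw [h]
    exact Even.zero
  have hsub : Finset.univ.erase b ⊆ A.image f := by
    rw [← (Finset.mem_filter.1 ha).2]
    exact Finset.image_subset_image (Finset.erase_subset _ _)
  have hAf : A.image f = Finset.univ.erase b := by
    refine (Finset.subset_erase.2 ⟨Finset.subset_univ _, fun hb => hf ?_⟩).antisymm hsub
    rw [Finset.eq_univ_iff_forall]
    intro x
    by_cases hx : x = b
    · rwa [hx]
    · exact hsub (by simpa using hx)
  rw [← hAf, card_filter_image_erase_eq]
  · exact even_two
  · rw [hAf, Finset.card_erase_add_one (Finset.mem_univ b), hA, Finset.card_univ]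

end Counting

namespace Scarf

section Dominance

variable {X I L : Type*} [LinearOrder L] {g : I → X → L} {σ τ : Finset X}

/-- A finite set `σ` is dominant for the preorders given by the functions `g i` if no point lies
strictly above the `g i`-minimum of `σ` for all `i` simultaneously. -/
def IsDominant (g : I → X → L) (σ : Finset X) : Prop :=
  ∀ y, ∃ i, ∀ x ∈ σ, g i y ≤ g i x

theorem IsDominant.mono (hσ : IsDominant g σ) (h : τ ⊆ σ) : IsDominant g τ := fun y =>
  (hσ y).imp fun _ hi x hx => hi x (h hx)

/-- The points that lie strictly above the `g i`-minimum of `τ` for all `i ≠ j`. The point that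
completes a dominant set `τ` to a room is always the `g j`-maximum of such a window. -/
def window (g : I → X → L) (τ : Finset X) (j : I) : Set X :=
  {y | ∀ i ≠ j, ∃ x ∈ τ, g i x < g i y}

theorem IsDominant.le_of_mem_window (hτ : IsDominant g τ) {j : I} {x y : X}
    (hy : y ∈ window g τ j) (hx : x ∈ τ) : g j y ≤ g j x := by
  obtain ⟨i, hi⟩ := hτ y
  obtain rfl : i = j := by
    by_contra hij
    obtain ⟨z, hz, hzy⟩ := hy i hij
    exact (hi z hz).not_gt hzy
  exact hi x hx

theorem window_anti {j : I} (h : τ ⊆ σ) : window g τ j ⊆ window g σ j := fun _ hy i hi =>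
  (hy i hi).imp fun _ hx => ⟨h hx.1, hx.2⟩

theorem IsDominant.eq_of_mem_window (hτ : IsDominant g τ) {i j : I} {y : X}
    (hi : y ∈ window g τ i) (hj : y ∈ window g τ j) : i = j := by
  by_contra hij
  obtain ⟨x, hx, hxy⟩ := hi j (Ne.symm hij)
  exact (hτ.le_of_mem_window hj hx).not_gt hxy

/-- The points `e i` are slack points for the preorders given by the functions `g i`: `e i` lies at
the bottom of the `i`-th preorder, and above all the points outside `range e` in the others. -/
structure IsSlack (g : I → X → L) (e : I → X) : Prop where
  bot : ∀ i x, x ≠ e i → g i (e i) < g i x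
  top : ∀ i j x, j ≠ i → x ∉ range e → g i x < g i (e j)

variable {e : I → X}

theorem IsSlack.bot_le (he : IsSlack g e) (i : I) (x : X) : g i (e i) ≤ g i x := by
  obtain rfl | hx := eq_or_ne x (e i)
  exacts [le_rfl, (he.bot i x hx).le]

theorem IsSlack.window_nonempty (he : IsSlack g e) {x : X} (hx : x ∈ τ) (hxe : x ∉ range e)
    (j : I) : (window g τ j).Nonempty :=
  ⟨e j, fun i hi => ⟨x, hx, he.top i j x hi.symm hxe⟩⟩

variable {c : X → I} {i₀ : I}

open Classical in
/-- The rooms of Scarf's parity argument: the dominant sets with as many points as there are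
preorders. -/
noncomputable def rooms [Fintype X] [Fintype I] (g : I → X → L) : Finset (Finset X) :=
  {σ | σ.card = Fintype.card I ∧ IsDominant g σ}

theorem mem_rooms [Fintype X] [Fintype I] :
    σ ∈ rooms g ↔ σ.card = Fintype.card I ∧ IsDominant g σ := by
  simp [rooms]

open Classical in
/-- The doors of Scarf's parity argument: the dominant sets with one point less than there are
preorders that show exactly the colours other than `i₀`. -/
noncomputable def doors [Fintype X] [Fintype I] [DecidableEq I] (g : I → X → L) (c : X → I)
    (i₀ : I) : Finset (Finset X) :=
  {τ | τ.card + 1 = Fintype.card I ∧ IsDominant g τ ∧ τ.image c = Finset.univ.erase i₀}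

theorem mem_doors [Fintype X] [Fintype I] [DecidableEq I] : τ ∈ doors g c i₀ ↔
    τ.card + 1 = Fintype.card I ∧ IsDominant g τ ∧ τ.image c = Finset.univ.erase i₀ := by
  simp [doors]

variable [DecidableEq X]

theorem IsDominant.insert_of_isMaxOn (hτ : IsDominant g τ) {j : I} {x : X}
    (hx : x ∈ window g τ j) (hmax : IsMaxOn (g j) (window g τ j) x) :
    IsDominant g (insert x τ) := by
  intro y
  by_cases hy : y ∈ window g τ j
  · exact ⟨j, Finset.forall_mem_insert _ _ _ |>.2
      ⟨hmax hy, fun z hz => hτ.le_of_mem_window hy hz⟩⟩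
  · simp only [window, mem_ofPred_eq, not_forall, not_exists, not_and, not_lt] at hy
    obtain ⟨i, hij, hi⟩ := hy
    obtain ⟨z, hz, hzx⟩ := hx i hij
    exact ⟨i, Finset.forall_mem_insert _ _ _ |>.2 ⟨(hi z hz).trans hzx.le, hi⟩⟩

theorem IsDominant.isMaxOn_window {j : I} {x : X} (hσ : IsDominant g (insert x τ)) :
    IsMaxOn (g j) (window g τ j) x := fun _ hy =>
  hσ.le_of_mem_window (window_anti (Finset.subset_insert x τ) hy) (Finset.mem_insert_self x τ)

open Classical in
/-- The points that complete `τ` to a larger dominant set. -/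
noncomputable def extensions [Fintype X] (g : I → X → L) (τ : Finset X) : Finset X :=
  {x | x ∉ τ ∧ IsDominant g (insert x τ)}

theorem mem_extensions [Fintype X] {x : X} :
    x ∈ extensions g τ ↔ x ∉ τ ∧ IsDominant g (insert x τ) := by
  simp [extensions]

theorem image_minimizers [Fintype I] {m : I → X} (hm : ∀ i, m i ∈ τ ∧ IsMinOn (g i) τ (m i))
    (hg : ∀ i, Function.Injective (g i)) (hτ : IsDominant g τ) : Finset.univ.image m = τ := by
  ext x
  simp only [Finset.mem_image, Finset.mem_univ, true_and]
  refine ⟨by rintro ⟨i, rfl⟩; exact (hm i).1, fun hx => ?_⟩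
  obtain ⟨i, hi⟩ := hτ x
  exact ⟨i, hg i (((hm i).2 hx).antisymm (hi _ (hm i).1))⟩

variable [Fintype I]

theorem notMem_of_mem_window [DecidableEq I] {m : I → X} (hm : ∀ i, IsMinOn (g i) τ (m i))
    {j : I} {x : X} (hj : (Finset.univ.erase j).image m = τ) (hx : x ∈ window g τ j) :
    x ∉ τ := by
  rw [← hj, Finset.mem_image]
  rintro ⟨i, hi, rfl⟩
  obtain ⟨z, hz, hzi⟩ := hx i (Finset.ne_of_mem_erase hi)
  exact (hm i hz).not_gt hzi

theorem exists_mem_window [DecidableEq I] {m : I → X} (hm : ∀ i, m i ∈ τ ∧ IsMinOn (g i) τ (m i))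
    (hg : ∀ i, Function.Injective (g i)) (hcard : τ.card + 1 = Fintype.card I) {x : X}
    (hx : x ∉ τ) (hσ : IsDominant g (insert x τ)) :
    ∃ j, (Finset.univ.erase j).image m = τ ∧ x ∈ window g τ j := by
  obtain ⟨j, hj⟩ := hσ x
  have hmin : ∀ z ∈ τ, ∃ i ≠ j, m i = z ∧ g i z < g i x := by
    intro z hz
    obtain ⟨i, hi⟩ := hσ z
    have hzx : g i z < g i x := (hi x (Finset.mem_insert_self x τ)).lt_of_ne fun h =>
      hx (hg i h ▸ hz)
    refine ⟨i, ?_, hg i (((hm i).2 hz).antisymm (hi _ (Finset.mem_insert_of_mem (hm i).1))), hzx⟩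
    rintro rfl
    exact (hj z (Finset.mem_insert_of_mem hz)).not_gt hzx
  have himage : (Finset.univ.erase j).image m = τ := by
    refine (Finset.image_subset_iff.2 fun i _ => (hm i).1).antisymm fun z hz => ?_
    obtain ⟨i, hij, hi, -⟩ := hmin z hz
    exact Finset.mem_image.2 ⟨i, by simpa using hij, hi⟩
  have hinj : Set.InjOn m (Finset.univ.erase j : Finset I) := by
    rw [← Finset.card_image_iff, himage, Finset.card_erase_of_mem (Finset.mem_univ j),
      Finset.card_univ]
    omega
  refine ⟨j, himage, fun i hij => ⟨m i, (hm i).1, ?_⟩⟩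
  obtain ⟨i', hi'j, hi', hlt⟩ := hmin (m i) (hm i).1
  rwa [hinj (by simpa using hi'j) (by simpa using hij) hi'] at hlt

theorem card_extensions [Fintype X] (hg : ∀ i, Function.Injective (g i)) (hτ : IsDominant g τ)
    (hne : τ.Nonempty) (hcard : τ.card + 1 = Fintype.card I)
    (hwindow : ∀ j, (window g τ j).Nonempty) : (extensions g τ).card = 2 := by
  classical
  choose m hmτ hm using fun i => τ.exists_min_image (g i) hne
  choose w hw hmax using fun j => (window g τ j).exists_max_image (g j) (toFinite _) (hwindow j)
  have hm' i : m i ∈ τ ∧ IsMinOn (g i) τ (m i) := ⟨hmτ i, hm i⟩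
  have hJ : {j ∈ (Finset.univ : Finset I) |
      (Finset.univ.erase j).image m = Finset.univ.image m}.card = 2 :=
    card_filter_image_erase_eq (by rw [image_minimizers hm' hg hτ, hcard, Finset.card_univ])
  rw [image_minimizers hm' hg hτ] at hJ
  rw [← hJ, eq_comm]
  refine Finset.card_bij (fun j _ => w j) (fun j hj => ?_) (fun i _ j _ hij => ?_) fun x hx => ?_
  · exact mem_extensions.2 ⟨notMem_of_mem_window hm (Finset.mem_filter.1 hj).2 (hw j),
      hτ.insert_of_isMaxOn (hw j) (hmax j)⟩
  · exact hτ.eq_of_mem_window (hw i) (hij ▸ hw j)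
  · obtain ⟨hxτ, hσ⟩ := mem_extensions.1 hx
    obtain ⟨j, hj, hxj⟩ := exists_mem_window hm' hg hcard hxτ hσ
    exact ⟨j, by simpa using hj,
      hg j ((hσ.isMaxOn_window (hw j)).antisymm (hmax j x hxj))⟩

variable [DecidableEq I]

theorem IsSlack.isDominant_boundary (he : IsSlack g e) (i₀ : I) :
    IsDominant g ((Finset.univ.erase i₀).image e) := by
  intro y
  by_cases hy : ∃ i ≠ i₀, e i = y
  · obtain ⟨i, -, rfl⟩ := hy
    exact ⟨i, fun x _ => he.bot_le i x⟩
  · refine ⟨i₀, Finset.forall_mem_image.2 fun i hi => ?_⟩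
    by_cases hye : y ∈ range e
    · obtain ⟨j, rfl⟩ := hye
      obtain rfl : j = i₀ := by_contra fun hj => hy ⟨j, hj, rfl⟩
      exact he.bot_le j (e i)
    · exact (he.top i₀ i y (Finset.ne_of_mem_erase hi) hye).le

theorem IsSlack.window_boundary (he : IsSlack g e) (i₀ : I) :
    window g ((Finset.univ.erase i₀).image e) i₀ =
      {y | y ∉ (Finset.univ.erase i₀).image e} := by
  ext y
  simp only [window, Finset.mem_image, Finset.mem_erase, Finset.mem_univ, and_true, mem_ofPred_eq]
  constructor
  · rintro hy ⟨i, hi, rfl⟩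
    obtain ⟨x, -, hx⟩ := hy i hi
    exact (he.bot_le i x).not_gt hx
  · exact fun hy i hi => ⟨e i, ⟨i, hi, rfl⟩, he.bot i y fun h => hy ⟨i, hi, h.symm⟩⟩

variable [Fintype X]

theorem IsSlack.card_extensions_boundary (he : IsSlack g e) (hg : ∀ i, Function.Injective (g i))
    (hinj : Function.Injective e) (i₀ : I) :
    (extensions g ((Finset.univ.erase i₀).image e)).card = 1 := by
  have he₀ : e i₀ ∈ window g ((Finset.univ.erase i₀).image e) i₀ := by
    simp [he.window_boundary, hinj.eq_iff]
  obtain ⟨p, hp, hmax⟩ := exists_max_image _ (g i₀) (toFinite _) ⟨_, he₀⟩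
  rw [Finset.card_eq_one]
  refine ⟨p, Finset.ext fun x => ?_⟩
  rw [mem_extensions, Finset.mem_singleton]
  refine ⟨fun ⟨hx, hσ⟩ => hg i₀ (le_antisymm (hmax x ?_) (hσ.isMaxOn_window hp)), ?_⟩
  · rwa [he.window_boundary]
  · rintro rfl
    exact ⟨by rwa [he.window_boundary] at hp, (he.isDominant_boundary i₀).insert_of_isMaxOn hp hmax⟩

theorem sum_card_extensions (g : I → X → L) (c : X → I) (i₀ : I) :
    ∑ τ ∈ doors g c i₀, (extensions g τ).card =
      ∑ σ ∈ rooms g, {x ∈ σ | (σ.erase x).image c = Finset.univ.erase i₀}.card := by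
  rw [← Finset.card_sigma, ← Finset.card_sigma]
  refine Finset.card_nbij' (fun p => ⟨insert p.2 p.1, p.2⟩) (fun p => ⟨p.1.erase p.2, p.2⟩)
    ?_ ?_ ?_ ?_
  · rintro ⟨τ, x⟩ hp
    simp only [Finset.coe_sigma, mem_sigma_iff, Finset.mem_coe, mem_doors, mem_extensions,
      mem_rooms, Finset.mem_filter] at hp ⊢
    obtain ⟨⟨hcard, -, hc⟩, hx, hσ⟩ := hp
    exact ⟨⟨by rw [Finset.card_insert_of_notMem hx, hcard], hσ⟩, Finset.mem_insert_self x τ,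
      by rwa [Finset.erase_insert hx]⟩
  · rintro ⟨σ, x⟩ hp
    simp only [Finset.coe_sigma, mem_sigma_iff, Finset.mem_coe, mem_doors, mem_extensions,
      mem_rooms, Finset.mem_filter] at hp ⊢
    obtain ⟨⟨hcard, hσ⟩, hx, hc⟩ := hp
    exact ⟨⟨by rw [Finset.card_erase_add_one hx, hcard], hσ.mono (Finset.erase_subset x σ), hc⟩,
      Finset.notMem_erase x σ, by rwa [Finset.insert_erase hx]⟩
  · rintro ⟨τ, x⟩ hp
    simp only [Finset.coe_sigma, mem_sigma_iff, Finset.mem_coe, mem_extensions] at hp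
    simp [Finset.erase_insert hp.2.1]
  · rintro ⟨σ, x⟩ hp
    simp only [Finset.coe_sigma, mem_sigma_iff, Finset.mem_coe, Finset.mem_filter] at hp
    simp [Finset.insert_erase hp.2.1]

theorem IsSlack.boundary_mem_doors (he : IsSlack g e) (hce : ∀ i, c (e i) = i)
    (i₀ : I) : (Finset.univ.erase i₀).image e ∈ doors g c i₀ := by
  refine mem_doors.2 ⟨?_, he.isDominant_boundary i₀, ?_⟩
  · rw [Finset.card_image_of_injective _ (Function.LeftInverse.injective hce),
      Finset.card_erase_add_one (Finset.mem_univ i₀), Finset.card_univ]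
  · simp [Finset.image_image, Function.comp_def, hce]

theorem eq_boundary_of_mem_doors (hce : ∀ i, c (e i) = i) (hτ : τ ∈ doors g c i₀)
    (hτe : ∀ x ∈ τ, x ∈ range e) : τ = (Finset.univ.erase i₀).image e := by
  rw [← (mem_doors.1 hτ).2.2, Finset.image_image]
  refine (Finset.image_id.symm.trans (Finset.image_congr fun x hx => ?_))
  obtain ⟨i, rfl⟩ := hτe x hx
  simp [hce]

end Dominance

/-- **Scarf's lemma**, for preorders with slack points. -/
theorem IsSlack.exists_isDominant_image_eq_univ {X I L : Type*} [LinearOrder L] [Finite X]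
    [Fintype I] [DecidableEq I] [Nonempty I] {g : I → X → L} {e : I → X} (he : IsSlack g e)
    (hg : ∀ i, Function.Injective (g i)) {c : X → I} (hce : ∀ i, c (e i) = i) :
    ∃ σ : Finset X, IsDominant g σ ∧ σ.image c = Finset.univ := by
  classical
  cases nonempty_fintype X
  by_contra! hcon
  obtain ⟨i₀⟩ := ‹Nonempty I›
  have hrooms : Even (∑ σ ∈ rooms g,
      {x ∈ σ | (σ.erase x).image c = Finset.univ.erase i₀}.card) :=
    Finset.even_sum _ fun σ hσ =>
      have ⟨hcard, hdom⟩ := mem_rooms.1 hσ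
      even_card_filter_image_erase_eq hcard (hcon σ hdom) i₀
  have hdoors : Even (∑ τ ∈ (doors g c i₀).erase ((Finset.univ.erase i₀).image e),
      (extensions g τ).card) := by
    refine Finset.even_sum _ fun τ hτ => ?_
    obtain ⟨hne, hτ⟩ := Finset.mem_erase.1 hτ
    obtain ⟨hcard, hdom, -⟩ := mem_doors.1 hτ
    obtain ⟨x, hx, hxe⟩ : ∃ x ∈ τ, x ∉ range e := by
      by_contra! hτe
      exact hne (eq_boundary_of_mem_doors hce hτ hτe)
    rw [card_extensions hg hdom ⟨x, hx⟩ hcard (he.window_nonempty hx hxe)]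
    exact even_two
  rw [← sum_card_extensions, ← Finset.sum_erase_add _ _ (he.boundary_mem_doors hce i₀),
    he.card_extensions_boundary hg (Function.LeftInverse.injective hce), Nat.even_add_one] at hrooms
  exact hrooms hdoors

section Slack

variable {X I L : Type*} [DecidableEq I]

/-- The extension of `g i` to `X ⊕ I` that puts the slack point `i` at the bottom and all the other
slack points at the top. -/
def slackValue (g : I → X → L) (i : I) : X ⊕ I → WithBot (WithTop L) :=
  Sum.elim (fun x => ((g i x : WithTop L) : WithBot (WithTop L))) fun j => if j = i then ⊥ else ⊤

open Classical in
/-- The functions `slackValue g i` with ties broken by an enumeration of the points. -/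
noncomputable def slackOrder [Fintype X] [Fintype I] (g : I → X → L) (i : I) (x : X ⊕ I) :
    WithBot (WithTop L) ×ₗ Fin (Fintype.card (X ⊕ I)) :=
  toLex (slackValue g i x, Fintype.equivFin _ x)

theorem slackOrder_injective [Fintype X] [Fintype I] (g : I → X → L) (i : I) :
    Function.Injective (slackOrder g i) := fun _ _ hxy =>
  (Fintype.equivFin _).injective (Prod.ext_iff.1 (toLex.injective hxy)).2

variable [LinearOrder L]

theorem slackValue_le_of_slackOrder_le [Fintype X] [Fintype I] {g : I → X → L} {i : I}
    {x y : X ⊕ I} (h : slackOrder g i x ≤ slackOrder g i y) : slackValue g i x ≤ slackValue g i y :=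
  (Prod.Lex.toLex_le_toLex.1 h).elim le_of_lt fun h => h.1.le

theorem isSlack_slackOrder [Fintype X] [Fintype I] (g : I → X → L) :
    IsSlack (slackOrder g) Sum.inr where
  bot := by
    rintro i (x | j) hx
    all_goals refine Prod.Lex.toLex_lt_toLex.2 (Or.inl ?_)
    · simp [slackValue]
    · have : j ≠ i := fun h => hx (by rw [h])
      simp [slackValue, this]
  top := by
    rintro i j (x | k) hij hx
    · refine Prod.Lex.toLex_lt_toLex.2 (Or.inl ?_)
      simpa [slackValue, hij] using WithBot.coe_lt_coe.2 (WithTop.coe_lt_top _)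
    · exact absurd ⟨k, rfl⟩ hx

/-- **Scarf's no-bullying lemma**. -/
theorem exists_subset_forall_exists_mem_image [Finite I] (A : Finset X)
    (g : I → X → L) (c : X → I) :
    ∃ S ⊆ A, ∀ y ∈ A, ∃ i ∈ S.image c, ∀ x ∈ S, g i y ≤ g i x := by
  obtain rfl | ⟨a, -⟩ := A.eq_empty_or_nonempty
  · exact ⟨∅, Finset.Subset.rfl, by simp⟩
  cases nonempty_fintype I
  have : Nonempty I := ⟨c a⟩
  obtain ⟨σ, hσ, hσc⟩ := (isSlack_slackOrder fun i (x : A) => g i x).exists_isDominant_image_eq_univ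
    (slackOrder_injective _) (c := Sum.elim (fun x : A => c x) id) fun i => rfl
  refine ⟨σ.toLeft.map (Function.Embedding.subtype _), fun x hx => ?_, fun y hy => ?_⟩
  · obtain ⟨x, -, rfl⟩ := Finset.mem_map.1 hx
    exact x.2
  obtain ⟨i, hi⟩ := hσ (Sum.inl ⟨y, hy⟩)
  have hiσ : Sum.inr i ∉ σ := fun h => by
    simpa [slackValue] using slackValue_le_of_slackOrder_le (hi _ h)
  refine ⟨i, ?_, fun x hx => ?_⟩
  · obtain ⟨x | j, hx, rfl⟩ := Finset.mem_image.1 (hσc ▸ Finset.mem_univ i)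
    · exact Finset.mem_image_of_mem c (by simpa using hx)
    · exact absurd hx hiσ
  · obtain ⟨x, hxσ, rfl⟩ := Finset.mem_map.1 hx
    simpa [slackValue] using slackValue_le_of_slackOrder_le (hi _ (Finset.mem_toLeft.1 hxσ))

end Slack

end Scarf

section Simplex

variable {ι κ : Type*} [Fintype ι] [Fintype κ]

theorem exists_mem_piAntidiag_ge [DecidableEq ι] [Nonempty ι] {a : ι → ℕ} {N : ℕ}
    (ha : ∑ i, a i ≤ N) : ∃ y ∈ Finset.piAntidiag Finset.univ N, a ≤ y := by
  refine ⟨a + Pi.single (Classical.arbitrary ι) (N - ∑ i, a i), ?_, le_self_add⟩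
  simp only [Finset.mem_piAntidiag, Finset.mem_univ, implies_true, and_true, Pi.add_apply,
    Finset.sum_add_distrib, Finset.sum_pi_single', if_true]
  omega

theorem exists_subset_piAntidiag_nearby_colours [DecidableEq ι] [Nonempty ι] (N : ℕ)
    (c : (ι → ℕ) → ι) :
    ∃ S ⊆ Finset.piAntidiag Finset.univ N, S.Nonempty ∧
      (∀ k ∈ S, ∀ l ∈ S, ∀ i, k i ≤ l i + Fintype.card ι) ∧
      ∀ i, i ∈ S.image c ∨ ∀ k ∈ S, k i ≤ Fintype.card ι := by
  obtain ⟨S, hSA, hS⟩ := Scarf.exists_subset_forall_exists_mem_image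
    (Finset.piAntidiag Finset.univ N) (fun i k => k i) c
  have hne : S.Nonempty := by
    obtain ⟨y, hy, -⟩ := exists_mem_piAntidiag_ge (a := (0 : ι → ℕ)) (N := N) (by simp)
    obtain ⟨i, hi, -⟩ := hS y hy
    exact Finset.image_nonempty.1 ⟨i, hi⟩
  let b : ι → ℕ := fun i => if i ∈ S.image c then S.inf' hne fun k => k i else 0
  have hbS : ∀ k ∈ S, ∀ i, b i ≤ k i := by
    intro k hk i
    by_cases hi : i ∈ S.image c
    · simpa only [b, if_pos hi] using Finset.inf'_le (fun k : ι → ℕ => k i) hk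
    · simp only [b, if_neg hi, zero_le]
  have hsum : N < ∑ i, (b i + 1) := by
    by_contra! hle
    obtain ⟨y, hy, hby⟩ := exists_mem_piAntidiag_ge hle
    obtain ⟨i, hi, hyS⟩ := hS y hy
    have : y i ≤ b i := by simpa only [b, if_pos hi] using Finset.le_inf' hne (fun k => k i) hyS
    exact absurd ((hby i).trans this) (by simp)
  have hSb : ∀ k ∈ S, ∀ i, k i ≤ b i + Fintype.card ι := by
    intro k hk i
    have hkN : ∑ j, k j = N := (Finset.mem_piAntidiag.1 (hSA hk)).1
    have hrest : ∑ j ∈ Finset.univ.erase i, b j ≤ ∑ j ∈ Finset.univ.erase i, k j :=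
      Finset.sum_le_sum fun j _ => hbS k hk j
    rw [Finset.sum_add_distrib, Finset.sum_const, Finset.card_univ, smul_eq_mul, mul_one,
      ← Finset.sum_erase_add _ _ (Finset.mem_univ i)] at hsum
    rw [← Finset.sum_erase_add _ _ (Finset.mem_univ i)] at hkN
    omega
  refine ⟨S, hSA, hne, fun k hk l hl i => (hSb k hk i).trans (by gcongr; exact hbS l hl i),
    fun i => or_iff_not_imp_left.2 fun hi k hk => ?_⟩
  simpa only [b, if_neg hi, zero_add] using hSb k hk i

theorem div_mem_stdSimplex_of_mem_piAntidiag [DecidableEq ι] {N : ℕ} (hN : N ≠ 0) {k : ι → ℕ}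
    (hk : k ∈ Finset.piAntidiag Finset.univ N) :
    (fun i => (k i : ℝ) / N) ∈ stdSimplex ℝ ι := by
  refine ⟨fun i => by positivity, ?_⟩
  rw [← Finset.sum_div, ← Nat.cast_sum, (Finset.mem_piAntidiag.1 hk).1]
  exact div_self (Nat.cast_ne_zero.2 hN)

theorem exists_mem_stdSimplex_infDist_le [Nonempty ι] {F : ι → Set (ι → ℝ)}
    (hF : ∀ t ∈ stdSimplex ℝ ι, ∃ i, t ∈ F i) {N : ℕ} (hN : N ≠ 0) :
    ∃ p ∈ stdSimplex ℝ ι, ∀ i,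
      Metric.infDist p (F i ∪ {t | t i = 0}) ≤ (Fintype.card ι : ℝ) / N := by
  classical
  have hcol : ∀ k : ι → ℕ, ∃ i, k ∈ Finset.piAntidiag Finset.univ N →
      (fun j => (k j : ℝ) / N) ∈ F i := by
    intro k
    by_cases hk : k ∈ Finset.piAntidiag Finset.univ N
    · exact (hF _ (div_mem_stdSimplex_of_mem_piAntidiag hN hk)).imp fun _ hi _ => hi
    · exact ⟨Classical.arbitrary ι, fun h => absurd h hk⟩
  choose c hc using hcol
  obtain ⟨S, hSA, ⟨l, hl⟩, hnear, hS⟩ := exists_subset_piAntidiag_nearby_colours N c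
  refine ⟨fun j => (l j : ℝ) / N, div_mem_stdSimplex_of_mem_piAntidiag hN (hSA hl), fun i => ?_⟩
  rcases hS i with hi | hi
  · obtain ⟨k, hk, rfl⟩ := Finset.mem_image.1 hi
    refine (Metric.infDist_le_dist_of_mem (mem_union_left _ (hc k (hSA hk)))).trans
      ((dist_pi_le_iff (by positivity)).2 fun j => ?_)
    rw [Real.dist_eq, ← sub_div, abs_div, Nat.abs_cast]
    gcongr
    have hkl : (k j : ℝ) ≤ l j + Fintype.card ι := by exact_mod_cast hnear k hk l hl j
    have hlk : (l j : ℝ) ≤ k j + Fintype.card ι := by exact_mod_cast hnear l hl k hk j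
    exact abs_sub_le_iff.2 ⟨by linarith, by linarith⟩
  · have hmem : Function.update (fun j => (l j : ℝ) / N) i 0 ∈ F i ∪ {t : ι → ℝ | t i = 0} :=
      Or.inr (Function.update_self ..)
    refine (Metric.infDist_le_dist_of_mem hmem).trans
      ((dist_pi_le_iff (by positivity)).2 fun j => ?_)
    obtain rfl | hj := eq_or_ne j i
    · rw [Function.update_self, Real.dist_0_eq_abs, abs_of_nonneg (by positivity)]
      gcongr
      exact hi l hl
    · rw [Function.update_of_ne hj, dist_self]
      positivity

/-- The **Knaster–Kuratowski–Mazurkiewicz theorem**, for covers dual to the usual ones. -/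
theorem exists_mem_stdSimplex_forall_mem_of_isClosed [Nonempty ι] {F : ι → Set (ι → ℝ)}
    (hclosed : ∀ i, IsClosed (F i)) (hcover : ∀ t ∈ stdSimplex ℝ ι, ∃ i, t ∈ F i)
    (hface : ∀ i, ∀ t ∈ stdSimplex ℝ ι, t i = 0 → t ∈ F i) :
    ∃ t ∈ stdSimplex ℝ ι, ∀ i, t ∈ F i := by
  classical
  let F' : ι → Set (ι → ℝ) := fun i => F i ∪ {t | t i = 0}
  obtain ⟨t, ht, hmin⟩ := (isCompact_stdSimplex ℝ ι).exists_isMinOn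
    ⟨_, single_mem_stdSimplex ℝ (Classical.arbitrary ι)⟩
    (continuous_finsetSum Finset.univ fun i _ =>
      Metric.continuous_infDist_pt (F' i)).continuousOn
  have hle : ∀ᶠ N : ℕ in atTop, ∑ i, Metric.infDist t (F' i) ≤
      Fintype.card ι * ((Fintype.card ι : ℝ) / N) := by
    filter_upwards [eventually_ne_atTop 0] with N hN
    obtain ⟨p, hp, hpF⟩ := exists_mem_stdSimplex_infDist_le hcover hN
    refine (hmin hp).trans ((Finset.sum_le_card_nsmul _ _ _ fun i _ => hpF i).trans_eq ?_)
    rw [Finset.card_univ, nsmul_eq_mul]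
  have hzero : ∑ i, Metric.infDist t (F' i) = 0 := by
    refine le_antisymm (ge_of_tendsto ?_ hle) (Finset.sum_nonneg fun i _ => Metric.infDist_nonneg)
    simpa using (tendsto_const_div_atTop_nhds_zero_nat (Fintype.card ι : ℝ)).const_mul
      (Fintype.card ι : ℝ)
  refine ⟨t, ht, fun i => ?_⟩
  have hclosed' : IsClosed (F' i) :=
    (hclosed i).union (isClosed_eq (continuous_apply i) continuous_const)
  have ht' : t ∈ F' i := (hclosed'.mem_iff_infDist_zero ⟨0, Or.inr rfl⟩).2
    ((Finset.sum_eq_zero_iff_of_nonneg fun i _ => Metric.infDist_nonneg).1 hzero i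
      (Finset.mem_univ i))
  exact ht'.elim id (hface i t ht)

/-- The **Gale–Nikaido–Debreu lemma** on market equilibria. -/
theorem exists_mem_stdSimplex_forall_nonpos [Nonempty ι] {g : (ι → ℝ) → ι → ℝ}
    (hg : ContinuousOn g (stdSimplex ℝ ι))
    (hwalras : ∀ t ∈ stdSimplex ℝ ι, ∑ i, t i * g t i ≤ 0) :
    ∃ t ∈ stdSimplex ℝ ι, ∀ i, g t i ≤ 0 := by
  have hpos : ∀ i, ContinuousOn (fun t => (g t i)⁺) (stdSimplex ℝ ι) := fun i =>
    continuous_posPart.comp_continuousOn (continuousOn_pi.1 hg i)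
  let F : ι → Set (ι → ℝ) := fun i =>
    {t ∈ stdSimplex ℝ ι | t i * ∑ k, (g t k)⁺ ≤ (g t i)⁺}
  have hsum : ∀ t ∈ stdSimplex ℝ ι, ∑ i, t i * ∑ k, (g t k)⁺ = ∑ i, (g t i)⁺ := fun t ht => by
    rw [← Finset.sum_mul, ht.2, one_mul]
  obtain ⟨t, ht, htF⟩ := exists_mem_stdSimplex_forall_mem_of_isClosed (F := F)
    (fun i => (isClosed_stdSimplex ℝ ι).isClosed_le ((continuous_apply i).continuousOn.mul
      (continuousOn_finsetSum _ fun k _ => hpos k)) (hpos i))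
    (fun t ht => by
      obtain ⟨i, -, hi⟩ := Finset.exists_le_of_sum_le Finset.univ_nonempty (hsum t ht).le
      exact ⟨i, ht, hi⟩)
    (fun i t ht hti => ⟨ht, by simp [hti]⟩)
  have heq : ∀ i, t i * ∑ k, (g t k)⁺ = (g t i)⁺ := fun i =>
    (Finset.sum_eq_sum_iff_of_le fun i _ => (htF i).2).1 (hsum t ht) i (Finset.mem_univ i)
  refine ⟨t, ht, fun i => ?_⟩
  by_contra! hi
  have hS : 0 ≤ ∑ k, (g t k)⁺ := Finset.sum_nonneg fun k _ => posPart_nonneg _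
  have hsq : ∑ k, (g t k)⁺ * (g t k)⁺ ≤ 0 := calc
    ∑ k, (g t k)⁺ * (g t k)⁺ = ∑ k, (g t k)⁺ * g t k := Finset.sum_congr rfl fun k _ => by
      rcases le_total (g t k) 0 with h | h
      · simp [posPart_eq_zero.2 h]
      · rw [posPart_eq_self.2 h]
    _ = (∑ k, (g t k)⁺) * ∑ k, t k * g t k := by
      rw [Finset.mul_sum]
      refine Finset.sum_congr rfl fun k _ => ?_
      rw [← heq k]
      ring
    _ ≤ 0 := mul_nonpos_of_nonneg_of_nonpos hS (hwalras t ht)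
  have hi' := (Finset.sum_eq_zero_iff_of_nonneg fun k _ => mul_self_nonneg _).1
    (hsq.antisymm (Finset.sum_nonneg fun k _ => mul_self_nonneg _)) i (Finset.mem_univ i)
  exact (posPart_pos hi).ne' (mul_self_eq_zero.1 hi')

theorem exists_sum_mul_le_of_mem_stdSimplex [Nonempty ι] {t : ι → ℝ} (ht : t ∈ stdSimplex ℝ ι)
    (w : ι → ℝ) : ∃ i, ∑ j, t j * w j ≤ w i := by
  obtain ⟨i, hi⟩ := Finite.exists_max w
  refine ⟨i, (Finset.sum_le_sum fun j _ => mul_le_mul_of_nonneg_left (hi j) (ht.1 j)).trans_eq ?_⟩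
  rw [← Finset.sum_mul, ht.2, one_mul]

theorem eq_sum_mul_of_pos_of_mem_stdSimplex {t w : ι → ℝ} (ht : t ∈ stdSimplex ℝ ι)
    (hw : ∀ i, w i ≤ ∑ j, t j * w j) {i : ι} (hi : 0 < t i) : w i = ∑ j, t j * w j := by
  have hsum : ∑ k, t k * w k = ∑ k, t k * ∑ j, t j * w j := by
    rw [← Finset.sum_mul, ht.2, one_mul]
  exact mul_left_cancel₀ hi.ne' ((Finset.sum_eq_sum_iff_of_le fun k _ =>
    mul_le_mul_of_nonneg_left (hw k) (ht.1 k)).1 hsum i (Finset.mem_univ i))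

theorem marginals_mem_stdSimplex {t : ι × κ → ℝ} (ht : t ∈ stdSimplex ℝ (ι × κ)) :
    (fun i => ∑ k, t (i, k)) ∈ stdSimplex ℝ ι ∧ (fun k => ∑ i, t (i, k)) ∈ stdSimplex ℝ κ :=
  ⟨⟨fun _ => Finset.sum_nonneg fun _ _ => ht.1 _, by rw [← Fintype.sum_prod_type, ht.2]⟩,
    ⟨fun _ => Finset.sum_nonneg fun _ _ => ht.1 _, by rw [← Fintype.sum_prod_type_right, ht.2]⟩⟩

theorem sum_mul_add_eq_sum_marginals (t : ι × κ → ℝ) (a : ι → ℝ) (b : κ → ℝ) :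
    ∑ x, t x * (a x.1 + b x.2) = ∑ i, (∑ k, t (i, k)) * a i + ∑ k, (∑ i, t (i, k)) * b k := by
  simp only [mul_add, Finset.sum_add_distrib, Finset.sum_mul]
  rw [Fintype.sum_prod_type, Fintype.sum_prod_type_right]

theorem sum_mul_sub_sum_mul {t : ι → ℝ} (ht : t ∈ stdSimplex ℝ ι) (w : ι → ℝ) :
    ∑ i, t i * (w i - ∑ j, t j * w j) = 0 := by
  simp only [mul_sub, Finset.sum_sub_distrib]
  rw [← Finset.sum_mul, ht.2, one_mul, sub_self]

theorem exists_equilibrium_stdSimplex_prod [Nonempty ι] [Nonempty κ]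
    {v : (ι → ℝ) × (κ → ℝ) → ι → ℝ} {w : (ι → ℝ) × (κ → ℝ) → κ → ℝ}
    (hv : ContinuousOn v (stdSimplex ℝ ι ×ˢ stdSimplex ℝ κ))
    (hw : ContinuousOn w (stdSimplex ℝ ι ×ˢ stdSimplex ℝ κ)) :
    ∃ p ∈ stdSimplex ℝ ι ×ˢ stdSimplex ℝ κ,
      (∀ i, v p i ≤ ∑ j, p.1 j * v p j) ∧ ∀ k, w p k ≤ ∑ l, p.2 l * w p l := by
  let marginals : (ι × κ → ℝ) → (ι → ℝ) × (κ → ℝ) := fun t =>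
    (fun i => ∑ k, t (i, k), fun k => ∑ i, t (i, k))
  have hmarg : Continuous marginals := by fun_prop
  have hmaps : MapsTo marginals (stdSimplex ℝ (ι × κ)) (stdSimplex ℝ ι ×ˢ stdSimplex ℝ κ) :=
    fun _ ht => marginals_mem_stdSimplex ht
  let gain : (ι → ℝ) × (κ → ℝ) → ι × κ → ℝ := fun p x =>
    (v p x.1 - ∑ j, p.1 j * v p j) + (w p x.2 - ∑ l, p.2 l * w p l)
  have hgain : ContinuousOn gain (stdSimplex ℝ ι ×ˢ stdSimplex ℝ κ) := by
    simp only [gain]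
    rw [continuousOn_pi] at hv hw ⊢
    fun_prop
  have hwalras : ∀ t ∈ stdSimplex ℝ (ι × κ), ∑ x, t x * gain (marginals t) x ≤ 0 := by
    intro t ht
    have hsplit := sum_mul_add_eq_sum_marginals t
      (fun i => v (marginals t) i - ∑ j, (marginals t).1 j * v (marginals t) j)
      (fun k => w (marginals t) k - ∑ l, (marginals t).2 l * w (marginals t) l)
    exact (hsplit.trans (congrArg₂ _ (sum_mul_sub_sum_mul (hmaps ht).1 _)
      (sum_mul_sub_sum_mul (hmaps ht).2 _))).trans (add_zero 0) |>.le
  obtain ⟨t, ht, hle⟩ := exists_mem_stdSimplex_forall_nonpos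
    (hgain.comp hmarg.continuousOn hmaps) hwalras
  refine ⟨marginals t, hmaps ht, fun i => ?_, fun k => ?_⟩
  · obtain ⟨k, hk⟩ := exists_sum_mul_le_of_mem_stdSimplex (hmaps ht).2 (w (marginals t))
    have := hle (i, k)
    simp only [Function.comp_apply, gain] at this
    linarith
  · obtain ⟨i, hi⟩ := exists_sum_mul_le_of_mem_stdSimplex (hmaps ht).1 (v (marginals t))
    have := hle (i, k)
    simp only [Function.comp_apply, gain] at this
    linarith

theorem eq_zero_of_le_sum_mul {t w : ι → ℝ} (ht : t ∈ stdSimplex ℝ ι)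
    (hw : ∀ i, w i ≤ ∑ j, t j * w j) (hsum : ∑ i, w i = 0) (hface : ∀ i, t i = 0 → 0 ≤ w i) :
    w = 0 := by
  cases isEmpty_or_nonempty ι
  · exact Subsingleton.elim _ _
  have hmean : 0 ≤ ∑ j, t j * w j := by
    obtain ⟨i, -, hi⟩ := Finset.exists_le_of_sum_le Finset.univ_nonempty
      (f := fun _ : ι => (0 : ℝ)) (g := w) (by simp [hsum])
    exact hi.trans (hw i)
  have hnonneg : ∀ i, 0 ≤ w i := fun i => by
    rcases (ht.1 i).eq_or_lt with hi | hi
    · exact hface i hi.symm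
    · exact (eq_sum_mul_of_pos_of_mem_stdSimplex ht hw hi).symm ▸ hmean
  exact funext fun i =>
    (Finset.sum_eq_zero_iff_of_nonneg fun i _ => hnonneg i).1 hsum i (Finset.mem_univ i)

end Simplex

section Analysis

theorem norm_sq_le_sum_sq {ι : Type*} [Fintype ι] (x : ι → ℝ) : ‖x‖ ^ 2 ≤ ∑ j, x j ^ 2 := by
  have hsum : 0 ≤ ∑ j, x j ^ 2 := Finset.sum_nonneg fun j _ => sq_nonneg _
  rw [← Real.le_sqrt (norm_nonneg _) hsum, pi_norm_le_iff_of_nonneg (Real.sqrt_nonneg _)]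
  exact fun j => Real.abs_le_sqrt
    (Finset.single_le_sum (f := fun j => x j ^ 2) (fun j _ => sq_nonneg _) (Finset.mem_univ j))

theorem sq_le_of_two_mul_mul_sq_le {γ a b x : ℝ} (hγ : 0 < γ)
    (hx : 2 * γ * x ^ 2 ≤ a + 2 * b * x) : x ^ 2 ≤ a / γ + (b / γ) ^ 2 := by
  have hamgm := sq_nonneg (x - b / γ)
  have hdiv : 2 * x ^ 2 ≤ a / γ + 2 * (b / γ) * x := by
    rw [← mul_le_mul_iff_right₀ hγ]
    calc γ * (2 * x ^ 2) = 2 * γ * x ^ 2 := by ring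
      _ ≤ a + 2 * b * x := hx
      _ = γ * (a / γ + 2 * (b / γ) * x) := by field_simp
  linarith

theorem eventually_lt_of_hasDerivWithinAt_pos {f : ℝ → ℝ} {f' x : ℝ}
    (hf : HasDerivWithinAt f f' (Ioi x) x) (hf' : 0 < f') : ∀ᶠ r in 𝓝[>] x, f x < f r := by
  have hslope := (hasDerivWithinAt_iff_tendsto_slope' self_notMem_Ioi).1 hf
  filter_upwards [hslope.eventually (lt_mem_nhds hf'), self_mem_nhdsWithin] with r hr hxr
  exact (slope_pos_iff_of_le (le_of_lt hxr)).1 hr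

end Analysis

noncomputable section

namespace MeanFieldGame

variable {d : ℕ} {c : Fin d → (Fin d → ℝ) → (Fin d → ℝ) → ℝ}

@[simp]
theorem diffOp_self (i : Fin d) (z : Fin d → ℝ) : diffOp i z i = 0 := sub_self _

@[simp]
theorem diffOp_diffOp (i : Fin d) (z : Fin d → ℝ) : diffOp i (diffOp i z) = diffOp i z := by
  funext j
  simp only [diffOp, sub_self, sub_zero]

@[fun_prop]
theorem continuous_diffOp (i : Fin d) : Continuous (diffOp i) := by
  unfold diffOp
  fun_prop

theorem abs_diffOp_sub_le (i j : Fin d) (z z' : Fin d → ℝ) :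
    |diffOp i z j - diffOp i z' j| ≤ 2 * ‖z - z'‖ := by
  have hi := abs_le.1 (norm_le_pi_norm (z - z') i)
  have hj := abs_le.1 (norm_le_pi_norm (z - z') j)
  simp only [Pi.sub_apply] at hi hj
  exact abs_le.2 ⟨by unfold diffOp; linarith, by unfold diffOp; linarith⟩

theorem sum_mul_diffOp_exchange_le (i : Fin d) (μ μ' z z' : Fin d → ℝ) :
    ∑ j, μ' j * diffOp i z j - ∑ j, μ j * diffOp i z j
      + (∑ j, μ j * diffOp i z' j - ∑ j, μ' j * diffOp i z' j)
      ≤ 2 * (d * ‖z' - z‖) * ‖μ' - μ‖ := calc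
  _ = ∑ j, -((μ' - μ) j * (diffOp i z' j - diffOp i z j)) := by
    rw [← Finset.sum_sub_distrib, ← Finset.sum_sub_distrib, ← Finset.sum_add_distrib]
    refine Finset.sum_congr rfl fun j _ => ?_
    rw [Pi.sub_apply]
    ring
  _ ≤ ∑ _j : Fin d, ‖μ' - μ‖ * (2 * ‖z' - z‖) := by
    refine Finset.sum_le_sum fun j _ => (neg_le_abs _).trans ?_
    rw [abs_mul]
    gcongr
    exacts [norm_le_pi_norm (μ' - μ) j, abs_diffOp_sub_le i j z' z]
  _ = 2 * (d * ‖z' - z‖) * ‖μ' - μ‖ := by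
    rw [Finset.sum_const, Finset.card_univ, Fintype.card_fin, nsmul_eq_mul]
    ring

theorem hamiltonianCost_diffOp (z θ : Fin d → ℝ) (i : Fin d) :
    hamiltonianCost c (diffOp i z) θ i = hamiltonianCost c z θ i := by
  unfold hamiltonianCost
  rw [diffOp_diffOp]

@[simp]
theorem h_diffOp (z θ : Fin d → ℝ) (i : Fin d) : h c (diffOp i z) θ i = h c z θ i := by
  rw [h, h, hamiltonianCost_diffOp]

theorem zero_mem_orthant : (0 : Fin d → ℝ) ∈ orthant d := fun _ => le_rfl

theorem update_zero_mem_orthant {α : Fin d → ℝ} (hα : α ∈ orthant d) (i : Fin d) :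
    Function.update α i 0 ∈ orthant d :=
  le_update_iff.2 ⟨le_rfl, fun j _ => hα j⟩

theorem convex_orthant : Convex ℝ (orthant d) := convex_Ici 0

theorem isClosed_orthant : IsClosed (orthant d) := isClosed_Ici

/-- The part of the assumptions on a running cost that gives existence, uniqueness and continuous
dependence of the optimal rates: Lipschitz dependence on the distribution, and differentiability
and uniform convexity in the rates of the jumps out of the current state. -/
structure IsUniformlyConvexCost (c : Fin d → (Fin d → ℝ) → (Fin d → ℝ) → ℝ) : Prop where
  lipschitz : ∃ K : ℝ, ∀ i, ∀ θ ∈ stdSimplex ℝ (Fin d), ∀ θ' ∈ stdSimplex ℝ (Fin d),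
    ∀ α ∈ orthant d, |c i θ α - c i θ' α| ≤ K * ‖θ - θ'‖
  differentiable : ∀ i, ∀ θ ∈ stdSimplex ℝ (Fin d), DifferentiableOn ℝ (c i θ) (orthant d)
  indep : ∀ i, ∀ θ ∈ stdSimplex ℝ (Fin d), ∀ α ∈ orthant d, ∀ α' ∈ orthant d,
    (∀ j, j ≠ i → α j = α' j) → c i θ α = c i θ α'
  uniform_convex : ∃ γ : ℝ, 0 < γ ∧ ∀ i, ∀ θ ∈ stdSimplex ℝ (Fin d),
    ∀ α ∈ orthant d, ∀ α' ∈ orthant d,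
      fderivWithin ℝ (c i θ) (orthant d) α (α' - α)
          + γ * ∑ j ∈ Finset.univ.erase i, (α' j - α j) ^ 2
        ≤ c i θ α' - c i θ α

theorem IsRunningCost.isUniformlyConvexCost (hc : IsRunningCost c) : IsUniformlyConvexCost c :=
  ⟨hc.lipschitz, hc.differentiable, hc.indep, hc.uniform_convex⟩

theorem norm_sub_sq_le_sum_erase {α α' : Fin d → ℝ} {i : Fin d} (hi : α' i = α i) :
    ‖α' - α‖ ^ 2 ≤ ∑ j ∈ Finset.univ.erase i, (α' j - α j) ^ 2 := by
  refine (norm_sq_le_sum_sq _).trans_eq (Finset.sum_erase _ ?_).symm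
  rw [Pi.sub_apply, hi, sub_self, zero_pow two_ne_zero]

namespace IsUniformlyConvexCost

theorem continuousOn (hc : IsUniformlyConvexCost c) (i : Fin d) :
    ContinuousOn (fun p : (Fin d → ℝ) × (Fin d → ℝ) => c i p.1 p.2)
      (stdSimplex ℝ (Fin d) ×ˢ orthant d) := by
  obtain ⟨K, hK⟩ := hc.lipschitz
  refine continuousOn_prod_of_continuousOn_lipschitzOnWith _ (Real.toNNReal K)
    (fun θ hθ => (hc.differentiable i θ hθ).continuousOn) fun α hα =>
    LipschitzOnWith.of_dist_le_mul fun θ hθ θ' hθ' => ?_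
  rw [Real.dist_eq, dist_eq_norm]
  exact (hK i θ hθ θ' hθ' α hα).trans
    (mul_le_mul_of_nonneg_right (Real.le_coe_toNNReal K) (norm_nonneg _))

theorem hamiltonianCost_update (hc : IsUniformlyConvexCost c) {θ : Fin d → ℝ}
    (hθ : θ ∈ stdSimplex ℝ (Fin d)) (z : Fin d → ℝ) (i : Fin d) {α : Fin d → ℝ}
    (hα : α ∈ orthant d) :
    hamiltonianCost c z θ i (Function.update α i 0) = hamiltonianCost c z θ i α := by
  unfold hamiltonianCost
  congr 1
  · exact hc.indep i θ hθ _ (update_zero_mem_orthant hα i) _ hα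
      fun j hj => Function.update_of_ne hj _ _
  · refine Finset.sum_congr rfl fun j _ => ?_
    obtain rfl | hj := eq_or_ne j i
    · rw [diffOp_self, mul_zero, mul_zero]
    · rw [Function.update_of_ne hj]

theorem exists_hasFDerivWithinAt_hamiltonianCost (hc : IsUniformlyConvexCost c) :
    ∃ γ : ℝ, 0 < γ ∧ ∀ i, ∀ θ ∈ stdSimplex ℝ (Fin d), ∀ z, ∀ α ∈ orthant d,
      ∃ D : (Fin d → ℝ) →L[ℝ] ℝ,
        HasFDerivWithinAt (hamiltonianCost c z θ i) D (orthant d) α ∧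
        ∀ α' ∈ orthant d, α' i = α i → D (α' - α) + γ * ‖α' - α‖ ^ 2
          ≤ hamiltonianCost c z θ i α' - hamiltonianCost c z θ i α := by
  obtain ⟨γ, hγ, hconv⟩ := hc.uniform_convex
  refine ⟨γ, hγ, fun i θ hθ z α hα => ?_⟩
  let L : (Fin d → ℝ) →L[ℝ] ℝ := ∑ j, diffOp i z j • ContinuousLinearMap.proj j
  have hL : ∀ μ, L μ = ∑ j, μ j * diffOp i z j := fun μ => by
    simp only [L, sum_apply, smul_apply,
      ContinuousLinearMap.proj_apply, smul_eq_mul, mul_comm]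
  have hH : hamiltonianCost c z θ i = fun μ => c i θ μ + L μ := by
    funext μ
    rw [hL, hamiltonianCost]
  refine ⟨fderivWithin ℝ (c i θ) (orthant d) α + L, ?_, fun α' hα' hi => ?_⟩
  · rw [hH]
    exact (hc.differentiable i θ hθ α hα).hasFDerivWithinAt.add L.hasFDerivWithinAt
  · have hstep := hconv i θ hθ α hα α' hα'
    have hsq := mul_le_mul_of_nonneg_left (norm_sub_sq_le_sum_erase hi) hγ.le
    rw [hH, add_apply, map_sub L]
    linarith

theorem exists_isMinOn (hc : IsUniformlyConvexCost c) {θ : Fin d → ℝ}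
    (hθ : θ ∈ stdSimplex ℝ (Fin d)) (z : Fin d → ℝ) (i : Fin d) :
    ∃ μ ∈ orthant d, IsMinOn (hamiltonianCost c z θ i) (orthant d) μ := by
  obtain ⟨γ, hγ, hderiv⟩ := hc.exists_hasFDerivWithinAt_hamiltonianCost
  obtain ⟨D, -, hD⟩ := hderiv i θ hθ z 0 zero_mem_orthant
  let S : Set (Fin d → ℝ) := orthant d ∩ {α | α i = 0}
  have hclosed : IsClosed S :=
    isClosed_orthant.inter (isClosed_eq (continuous_apply i) continuous_const)
  have hcont : ContinuousOn (hamiltonianCost c z θ i) S := fun α hα =>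
    let ⟨_, hα', _⟩ := hderiv i θ hθ z α hα.1
    hα'.continuousWithinAt.mono inter_subset_left
  have hcoercive : ∀ᶠ α in cocompact (Fin d → ℝ) ⊓ 𝓟 S,
      hamiltonianCost c z θ i 0 ≤ hamiltonianCost c z θ i α := by
    filter_upwards [(tendsto_norm_cocompact_atTop.eventually_ge_atTop (‖D‖ / γ)).filter_mono
      inf_le_left, mem_inf_of_right (mem_principal_self S)] with α hnorm hα
    have hgrad := hD α hα.1 hα.2
    have hop := (abs_le.1 (D.le_opNorm α)).1
    have hlarge := mul_le_mul_of_nonneg_right ((div_le_iff₀' hγ).1 hnorm) (norm_nonneg α)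
    rw [sub_zero] at hgrad
    linarith
  obtain ⟨μ, hμ, hmin⟩ := hcont.exists_isMinOn' hclosed ⟨zero_mem_orthant, rfl⟩ hcoercive
  refine ⟨μ, hμ.1, fun α hα => ?_⟩
  rw [mem_ofPred_eq, ← hc.hamiltonianCost_update hθ z i hα]
  exact hmin ⟨update_zero_mem_orthant hα i, Function.update_self ..⟩

theorem exists_quadratic_growth (hc : IsUniformlyConvexCost c) :
    ∃ γ : ℝ, 0 < γ ∧ ∀ i, ∀ θ ∈ stdSimplex ℝ (Fin d), ∀ z, ∀ α ∈ orthant d,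
      IsMinOn (hamiltonianCost c z θ i) (orthant d) α → ∀ α' ∈ orthant d, α' i = α i →
        γ * ‖α' - α‖ ^ 2 ≤ hamiltonianCost c z θ i α' - hamiltonianCost c z θ i α := by
  obtain ⟨γ, hγ, hderiv⟩ := hc.exists_hasFDerivWithinAt_hamiltonianCost
  refine ⟨γ, hγ, fun i θ hθ z α hα hmin α' hα' hi => ?_⟩
  obtain ⟨D, hD, hgrad⟩ := hderiv i θ hθ z α hα
  have hfirst : 0 ≤ D (α' - α) := hmin.localize.hasFDerivWithinAt_nonneg hD
    (sub_mem_posTangentConeAt_of_segment_subset (convex_orthant.segment_subset hα hα'))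
  linarith [hgrad α' hα' hi]

end IsUniformlyConvexCost

/-- The minimizer `argminRate c z θ i` normalized to have `i`-th coordinate `0`. For a uniformly
convex cost this makes it unique, hence continuous in `(z, θ)`; the chosen minimizer itself has an
arbitrary `i`-th coordinate. -/
def optimalRate (c : Fin d → (Fin d → ℝ) → (Fin d → ℝ) → ℝ) (z θ : Fin d → ℝ) (i : Fin d) :
    Fin d → ℝ :=
  Function.update (argminRate c z θ i) i 0

@[simp]
theorem optimalRate_self (z θ : Fin d → ℝ) (i : Fin d) : optimalRate c z θ i i = 0 :=
  Function.update_self ..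

theorem αStar_of_ne (z θ : Fin d → ℝ) {i j : Fin d} (hj : j ≠ i) :
    αStar c z θ i j = optimalRate c z θ i j := by
  rw [αStar, if_neg hj, optimalRate, Function.update_of_ne hj]

theorem αStar_self (z θ : Fin d → ℝ) (i : Fin d) :
    αStar c z θ i i = -∑ j, optimalRate c z θ i j := by
  rw [αStar, if_pos rfl, ← Finset.sum_erase _ (optimalRate_self z θ i)]
  exact congrArg _ (Finset.sum_congr rfl fun j hj =>
    (Function.update_of_ne (Finset.ne_of_mem_erase hj) _ _).symm)

theorem sum_αStar (z θ : Fin d → ℝ) (i : Fin d) : ∑ j, αStar c z θ i j = 0 := by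
  rw [← Finset.sum_erase_add _ _ (Finset.mem_univ i), αStar_self,
    ← Finset.sum_erase _ (optimalRate_self z θ i), add_neg_eq_zero]
  exact Finset.sum_congr rfl fun j hj => αStar_of_ne z θ (Finset.ne_of_mem_erase hj)

namespace IsUniformlyConvexCost

theorem argminRate_mem_and_isMinOn (hc : IsUniformlyConvexCost c) {θ : Fin d → ℝ}
    (hθ : θ ∈ stdSimplex ℝ (Fin d)) (z : Fin d → ℝ) (i : Fin d) :
    argminRate c z θ i ∈ orthant d ∧
      IsMinOn (hamiltonianCost c z θ i) (orthant d) (argminRate c z θ i) := by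
  have hexists := hc.exists_isMinOn hθ z i
  rw [argminRate, dif_pos hexists]
  exact hexists.choose_spec

theorem optimalRate_mem_orthant (hc : IsUniformlyConvexCost c) {θ : Fin d → ℝ}
    (hθ : θ ∈ stdSimplex ℝ (Fin d)) (z : Fin d → ℝ) (i : Fin d) :
    optimalRate c z θ i ∈ orthant d :=
  update_zero_mem_orthant (hc.argminRate_mem_and_isMinOn hθ z i).1 i

theorem isMinOn_optimalRate (hc : IsUniformlyConvexCost c) {θ : Fin d → ℝ}
    (hθ : θ ∈ stdSimplex ℝ (Fin d)) (z : Fin d → ℝ) (i : Fin d) :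
    IsMinOn (hamiltonianCost c z θ i) (orthant d) (optimalRate c z θ i) := by
  obtain ⟨hmem, hmin⟩ := hc.argminRate_mem_and_isMinOn hθ z i
  exact fun α hα => (hc.hamiltonianCost_update hθ z i hmem).trans_le (hmin hα)

theorem h_eq_hamiltonianCost (hc : IsUniformlyConvexCost c) {θ : Fin d → ℝ}
    (hθ : θ ∈ stdSimplex ℝ (Fin d)) (z : Fin d → ℝ) (i : Fin d) :
    h c z θ i = hamiltonianCost c z θ i (optimalRate c z θ i) :=
  IsLeast.csInf_eq ⟨mem_image_of_mem _ (hc.optimalRate_mem_orthant hθ z i),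
    forall_mem_image.2 (hc.isMinOn_optimalRate hθ z i)⟩

theorem αStar_nonneg (hc : IsUniformlyConvexCost c) {θ : Fin d → ℝ}
    (hθ : θ ∈ stdSimplex ℝ (Fin d)) (z : Fin d → ℝ) {i j : Fin d} (hj : j ≠ i) :
    0 ≤ αStar c z θ i j :=
  (hc.optimalRate_mem_orthant hθ z i j).trans_eq (αStar_of_ne z θ hj).symm

theorem exists_sq_norm_optimalRate_sub_le (hc : IsUniformlyConvexCost c) :
    ∃ A B : ℝ, ∀ i, ∀ θ ∈ stdSimplex ℝ (Fin d), ∀ θ' ∈ stdSimplex ℝ (Fin d), ∀ z z',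
      ‖optimalRate c z' θ' i - optimalRate c z θ i‖ ^ 2
        ≤ A * ‖θ' - θ‖ + B * ‖z' - z‖ ^ 2 := by
  obtain ⟨K, hK⟩ := hc.lipschitz
  obtain ⟨γ, hγ, hgrowth⟩ := hc.exists_quadratic_growth
  refine ⟨2 * K / γ, (d / γ) ^ 2, fun i θ hθ θ' hθ' z z' => ?_⟩
  have hμ := hc.optimalRate_mem_orthant hθ z i
  have hμ' := hc.optimalRate_mem_orthant hθ' z' i
  have hgrow := hgrowth i θ hθ z _ hμ (hc.isMinOn_optimalRate hθ z i) _ hμ' (by simp)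
  have hgrow' := hgrowth i θ' hθ' z' _ hμ' (hc.isMinOn_optimalRate hθ' z' i) _ hμ (by simp)
  generalize optimalRate c z θ i = μ at *
  generalize optimalRate c z' θ' i = μ' at *
  have hcost := (abs_le.1 (hK i θ' hθ' θ hθ μ hμ)).2
  have hcost' := (abs_le.1 (hK i θ' hθ' θ hθ μ' hμ')).1
  have hlin := sum_mul_diffOp_exchange_le i μ μ' z z'
  rw [norm_sub_rev μ] at hgrow'
  unfold hamiltonianCost at hgrow hgrow'
  have hsum : 2 * γ * ‖μ' - μ‖ ^ 2
      ≤ 2 * K * ‖θ' - θ‖ + 2 * (d * ‖z' - z‖) * ‖μ' - μ‖ := by linarith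
  calc ‖μ' - μ‖ ^ 2 ≤ 2 * K * ‖θ' - θ‖ / γ + (d * ‖z' - z‖ / γ) ^ 2 :=
        sq_le_of_two_mul_mul_sq_le hγ hsum
    _ = 2 * K / γ * ‖θ' - θ‖ + (d / γ) ^ 2 * ‖z' - z‖ ^ 2 := by ring

theorem continuousOn_optimalRate (hc : IsUniformlyConvexCost c) (i : Fin d) :
    ContinuousOn (fun p : (Fin d → ℝ) × (Fin d → ℝ) => optimalRate c p.1 p.2 i)
      (univ ×ˢ stdSimplex ℝ (Fin d)) := by
  obtain ⟨A, B, hAB⟩ := hc.exists_sq_norm_optimalRate_sub_le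
  rintro ⟨z, θ⟩ ⟨-, hθ⟩
  have hbound : Continuous fun p : (Fin d → ℝ) × (Fin d → ℝ) =>
      √(A * ‖p.2 - θ‖ + B * ‖p.1 - z‖ ^ 2) := by fun_prop
  refine tendsto_iff_norm_sub_tendsto_zero.2 (squeeze_zero' (Eventually.of_forall fun _ =>
    norm_nonneg _) ?_ (hbound.tendsto' (z, θ) 0 (by simp) |>.mono_left nhdsWithin_le_nhds))
  filter_upwards [self_mem_nhdsWithin] with p hp
  exact Real.le_sqrt_of_sq_le (hAB i θ hθ p.2 hp.2 z p.1)

theorem continuousOn_h (hc : IsUniformlyConvexCost c) (i : Fin d) :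
    ContinuousOn (fun p : (Fin d → ℝ) × (Fin d → ℝ) => h c p.1 p.2 i)
      (univ ×ˢ stdSimplex ℝ (Fin d)) := by
  have hrate := hc.continuousOn_optimalRate i
  have hcost : ContinuousOn (fun p : (Fin d → ℝ) × (Fin d → ℝ) =>
      c i p.2 (optimalRate c p.1 p.2 i)) (univ ×ˢ stdSimplex ℝ (Fin d)) :=
    (hc.continuousOn i).comp (continuousOn_snd.prodMk hrate) fun p hp =>
      ⟨hp.2, hc.optimalRate_mem_orthant hp.2 p.1 i⟩
  refine (hcost.add (continuousOn_finsetSum Finset.univ fun j _ =>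
    (continuousOn_pi.1 hrate j).mul (Continuous.continuousOn ?_))).congr fun p hp =>
      hc.h_eq_hamiltonianCost hp.2 p.1 i
  exact (continuous_apply j).comp ((continuous_diffOp i).comp continuous_fst)

theorem continuousOn_αStar (hc : IsUniformlyConvexCost c) (i j : Fin d) :
    ContinuousOn (fun p : (Fin d → ℝ) × (Fin d → ℝ) => αStar c p.1 p.2 i j)
      (univ ×ˢ stdSimplex ℝ (Fin d)) := by
  have hrate := continuousOn_pi.1 (hc.continuousOn_optimalRate i)
  obtain rfl | hj := eq_or_ne j i
  · simp only [αStar_self]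
    exact (continuousOn_finsetSum _ fun k _ => hrate k).neg
  · simp only [αStar_of_ne _ _ hj]
    exact hrate j

theorem continuousOn_αStar_diffOp (hc : IsUniformlyConvexCost c) (i j : Fin d) :
    ContinuousOn (fun p : (Fin d → ℝ) × (Fin d → ℝ) => αStar c (diffOp i p.1) p.2 i j)
      (univ ×ˢ stdSimplex ℝ (Fin d)) := by
  have hpair : Continuous fun p : (Fin d → ℝ) × (Fin d → ℝ) => (diffOp i p.1, p.2) := by fun_prop
  have hmaps : MapsTo (fun p : (Fin d → ℝ) × (Fin d → ℝ) => (diffOp i p.1, p.2))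
      (univ ×ˢ stdSimplex ℝ (Fin d)) (univ ×ˢ stdSimplex ℝ (Fin d)) :=
    fun _ hp => ⟨mem_univ _, hp.2⟩
  simpa only [Function.comp_def] using (hc.continuousOn_αStar i j).comp hpair.continuousOn hmaps

theorem continuousOn_inflow (hc : IsUniformlyConvexCost c) (i : Fin d) :
    ContinuousOn (fun p : (Fin d → ℝ) × (Fin d → ℝ) =>
      ∑ j, p.2 j * αStar c (diffOp j p.1) p.2 j i) (univ ×ˢ stdSimplex ℝ (Fin d)) :=
  continuousOn_finsetSum _ fun j _ =>
    ((continuous_apply j).comp continuous_snd).continuousOn.mul (hc.continuousOn_αStar_diffOp j i)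

end IsUniformlyConvexCost

theorem sub_div_two_le_sharpNorm (u : Fin d → ℝ) (i j : Fin d) :
    (u i - u j) / 2 ≤ sharpNorm u := by
  refine le_ciInf fun l => ?_
  have hi := (abs_le.1 (norm_le_pi_norm (u + fun _ => l) i)).2
  have hj := (abs_le.1 (norm_le_pi_norm (u + fun _ => l) j)).1
  simp only [Pi.add_apply] at hi hj
  linarith

theorem sharpNorm_le (u : Fin d → ℝ) (l : ℝ) : sharpNorm u ≤ ‖u + fun _ => l‖ :=
  ciInf_le ⟨0, forall_mem_range.2 fun _ => norm_nonneg _⟩ l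

theorem sharpNorm_eq_sub_div_two {u : Fin d → ℝ} {i j : Fin d} (hi : ∀ k, u k ≤ u i)
    (hj : ∀ k, u j ≤ u k) : sharpNorm u = (u i - u j) / 2 := by
  refine le_antisymm ((sharpNorm_le u (-(u i + u j) / 2)).trans ?_)
    (sub_div_two_le_sharpNorm u i j)
  refine (pi_norm_le_iff_of_nonneg (by linarith [hi j])).2 fun k => abs_le.2 ?_
  rw [Pi.add_apply]
  constructor <;> linarith [hi k, hj k]

theorem lipschitzWith_sharpNorm : LipschitzWith 1 (sharpNorm (d := d)) := by
  refine LipschitzWith.of_le_add fun u v => sub_le_iff_le_add.1 (le_ciInf fun l => ?_)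
  rw [sub_le_iff_le_add, dist_eq_norm]
  calc sharpNorm u ≤ ‖u + fun _ => l‖ := sharpNorm_le u l
    _ = ‖(v + fun _ => l) + (u - v)‖ := by congr 1; abel
    _ ≤ ‖v + fun _ => l‖ + ‖u - v‖ := norm_add_le _ _

theorem IsContractive.exists_h_lt_h (hh : IsContractive c) :
    ∃ M : ℝ, ∀ θ ∈ stdSimplex ℝ (Fin d), ∀ u, M < sharpNorm u → ∀ i j,
      (∀ k, u k ≤ u i) → (∀ k, u j ≤ u k) → h c u θ i < h c u θ j := by
  obtain ⟨M, -, hM⟩ := hh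
  refine ⟨M, fun θ hθ u hu i j hi hj => ?_⟩
  have hmax := (hM θ hθ i u hu).1 fun k => sub_nonpos.2 (hi k)
  have hmin := (hM θ hθ j u hu).2 fun k => sub_nonneg.2 (hj k)
  rw [h_diffOp] at hmax hmin
  linarith

theorem IsSolution.hasDerivWithinAt_sub {a b : ℝ} {θ u : ℝ → Fin d → ℝ}
    (hsol : IsSolution c a b θ u) {s : ℝ} (hs : s ∈ Ico a b) (i j : Fin d) :
    HasDerivWithinAt (fun r => u r i - u r j) (h c (u s) (θ s) j - h c (u s) (θ s) i)
      (Ioi s) s := by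
  have hderiv := (hsol.hamiltonJacobi s (Ico_subset_Icc_self hs) i).sub
    (hsol.hamiltonJacobi s (Ico_subset_Icc_self hs) j)
  rw [h_diffOp, h_diffOp, neg_sub_neg] at hderiv
  exact hderiv.mono_of_mem_nhdsWithin (Icc_mem_nhdsGT_of_mem hs)

theorem IsSolution.continuousOn_sharpNorm {a b : ℝ} {θ u : ℝ → Fin d → ℝ}
    (hsol : IsSolution c a b θ u) : ContinuousOn (fun s => sharpNorm (u s)) (Icc a b) :=
  lipschitzWith_sharpNorm.continuous.comp_continuousOn
    (continuousOn_pi.2 fun i s hs => (hsol.hamiltonJacobi s hs i).continuousWithinAt)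

theorem IsContractive.exists_isBackwardInvariant [Nonempty (Fin d)] (hh : IsContractive c) :
    ∃ M₀ : ℝ, ∀ M : ℝ, M₀ ≤ M →
      IsBackwardInvariant c ({u : Fin d → ℝ | sharpNorm u < M} ×ˢ stdSimplex ℝ (Fin d)) := by
  obtain ⟨M₁, hM₁⟩ := hh.exists_h_lt_h
  refine ⟨M₁ + 1, fun M hM a b θ u _ hsol hb t ht => ⟨?_, hsol.mem_simplex t ht⟩⟩
  have hsub : Icc t b ⊆ Icc a b := Icc_subset_Icc_left ht.1
  by_contra ht_notMem
  have ht_large : M ≤ sharpNorm (u t) := not_lt.1 ht_notMem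
  let T : Set ℝ := {s | M ≤ sharpNorm (u s)}
  have hclosed : IsClosed (T ∩ Icc t b) := by
    rw [inter_comm]
    exact (hsol.continuousOn_sharpNorm.mono hsub).preimage_isClosed_of_isClosed isClosed_Icc
      isClosed_Ici
  have hb_small : sharpNorm (u b) < M := hb.1
  refine hb_small.not_ge (hclosed.Icc_subset_of_forall_mem_nhdsWithin ht_large
    (fun s hs => ?_) (right_mem_Icc.2 ht.2))
  have hsM : M ≤ sharpNorm (u s) := hs.1
  have hsab : s ∈ Ico a b := ⟨ht.1.trans hs.2.1, hs.2.2⟩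
  obtain ⟨i, hi⟩ := Finite.exists_max (u s)
  obtain ⟨j, hj⟩ := Finite.exists_min (u s)
  have hh_lt : h c (u s) (θ s) i < h c (u s) (θ s) j :=
    hM₁ (θ s) (hsol.mem_simplex s (Ico_subset_Icc_self hsab)) (u s) (by linarith) i j hi hj
  filter_upwards [eventually_lt_of_hasDerivWithinAt_pos (hsol.hasDerivWithinAt_sub hsab i j)
    (sub_pos.2 hh_lt)] with r hr
  have hosc := sharpNorm_eq_sub_div_two hi hj
  have hosc_r := sub_div_two_le_sharpNorm (u r) i j
  exact (show M ≤ sharpNorm (u r) by linarith)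

theorem IsContractive.exists_eq_sum_mul_h (hh : IsContractive c) :
    ∃ R : ℝ, ∀ s ∈ stdSimplex ℝ (Fin d), ∀ θ ∈ stdSimplex ℝ (Fin d),
      (∀ i, h c (R • s) θ i ≤ ∑ j, s j * h c (R • s) θ j) →
        ∀ i, h c (R • s) θ i = ∑ j, s j * h c (R • s) θ j := by
  obtain ⟨M, hM₀, hM⟩ := hh
  refine ⟨2 * d * (M + 1), fun s hs θ hθ hle j => (hle j).eq_of_not_lt fun hj => ?_⟩
  have hdpos : (0 : ℝ) < d := Nat.cast_pos.2 (Fin.pos j)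
  set u := (2 * d * (M + 1)) • s
  have hsj : s j = 0 := (hs.1 j).eq_or_lt.elim Eq.symm fun hsj =>
    absurd (eq_sum_mul_of_pos_of_mem_stdSimplex hs hle hsj) hj.ne
  obtain ⟨i, hi⟩ := have : Nonempty (Fin d) := ⟨j⟩; Finite.exists_max s
  have hsi : 1 ≤ d * s i := by
    simpa [hs.2] using Finset.sum_le_card_nsmul Finset.univ s (s i) fun k _ => hi k
  have hsharp : M < sharpNorm u := by
    refine lt_of_lt_of_le ?_ (sub_div_two_le_sharpNorm u i j)
    simp only [u, Pi.smul_apply, smul_eq_mul, hsj]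
    nlinarith
  have havg : (1 / (d : ℝ)) * ∑ k, h c u θ k < ∑ k, s k * h c u θ k := by
    have hlt := Finset.sum_lt_sum (fun k _ => hle k) ⟨j, Finset.mem_univ j, hj⟩
    rw [Finset.sum_const, Finset.card_univ, Fintype.card_fin, nsmul_eq_mul] at hlt
    rwa [one_div_mul_eq_div, div_lt_iff₀' hdpos]
  have hcontr := (hM θ hθ i u hsharp).1 fun k =>
    sub_nonpos.2 (mul_le_mul_of_nonneg_left (hi k) (by positivity))
  rw [h_diffOp, eq_sum_mul_of_pos_of_mem_stdSimplex hs hle (by nlinarith)] at hcontr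
  linarith

theorem IsUniformlyConvexCost.eq_zero_of_inflow_le (hc : IsUniformlyConvexCost c)
    {θ u : Fin d → ℝ} (hθ : θ ∈ stdSimplex ℝ (Fin d))
    (hle : ∀ i, ∑ j, θ j * αStar c (diffOp j u) θ j i
      ≤ ∑ k, θ k * ∑ j, θ j * αStar c (diffOp j u) θ j k) (i : Fin d) :
    ∑ j, θ j * αStar c (diffOp j u) θ j i = 0 := by
  refine congrFun (eq_zero_of_le_sum_mul hθ hle ?_ fun k hk => Finset.sum_nonneg fun j _ => ?_) i
  · rw [Finset.sum_comm]
    refine Finset.sum_eq_zero fun j _ => ?_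
    rw [← Finset.mul_sum, sum_αStar, mul_zero]
  · obtain rfl | hkj := eq_or_ne k j
    · rw [hk, zero_mul]
    · exact mul_nonneg (hθ.1 j) (hc.αStar_nonneg hθ _ hkj)

theorem IsUniformlyConvexCost.exists_isStationarySolution [Nonempty (Fin d)]
    (hc : IsUniformlyConvexCost c) (hh : IsContractive c) :
    ∃ (θ u : Fin d → ℝ) (κ : ℝ), IsStationarySolution c θ u κ := by
  obtain ⟨R, hR⟩ := hh.exists_eq_sum_mul_h
  have hscale : ContinuousOn (fun p : (Fin d → ℝ) × (Fin d → ℝ) => (R • p.1, p.2))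
      (stdSimplex ℝ (Fin d) ×ˢ stdSimplex ℝ (Fin d)) := by fun_prop
  have hmaps : MapsTo (fun p : (Fin d → ℝ) × (Fin d → ℝ) => (R • p.1, p.2))
      (stdSimplex ℝ (Fin d) ×ˢ stdSimplex ℝ (Fin d)) (univ ×ˢ stdSimplex ℝ (Fin d)) :=
    fun _ hp => ⟨mem_univ _, hp.2⟩
  have hvalue : ContinuousOn (fun p : (Fin d → ℝ) × (Fin d → ℝ) => h c (R • p.1) p.2)
      (stdSimplex ℝ (Fin d) ×ˢ stdSimplex ℝ (Fin d)) := continuousOn_pi.2 fun i => by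
    simpa only [Function.comp_def] using (hc.continuousOn_h i).comp hscale hmaps
  have hinflow : ContinuousOn (fun (p : (Fin d → ℝ) × (Fin d → ℝ)) i =>
      ∑ j, p.2 j * αStar c (diffOp j (R • p.1)) p.2 j i)
      (stdSimplex ℝ (Fin d) ×ˢ stdSimplex ℝ (Fin d)) := continuousOn_pi.2 fun i => by
    simpa only [Function.comp_def] using (hc.continuousOn_inflow i).comp hscale hmaps
  obtain ⟨⟨s, θ⟩, ⟨hs, hθ⟩, hv, hw⟩ := exists_equilibrium_stdSimplex_prod hvalue hinflow
  refine ⟨θ, R • s, ∑ j, s j * h c (R • s) θ j, hθ, hc.eq_zero_of_inflow_le hθ hw, fun i => ?_⟩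
  rw [h_diffOp]
  exact hR s hs θ hθ hv i

end MeanFieldGame

end

theorem proposition2p8_general (d : ℕ) (hd : 1 ≤ d)
    (c : Fin d → (Fin d → ℝ) → (Fin d → ℝ) → ℝ)
    (hc : MeanFieldGame.IsUniformlyConvexCost c) (hh : MeanFieldGame.IsContractive c) :
    (∃ M₀ : ℝ, ∀ M : ℝ, M₀ ≤ M →
      MeanFieldGame.IsBackwardInvariant c
        ({u : Fin d → ℝ | MeanFieldGame.sharpNorm u < M} ×ˢ stdSimplex ℝ (Fin d))) ∧
    (∃ (θ u : Fin d → ℝ) (κ : ℝ), MeanFieldGame.IsStationarySolution c θ u κ) := by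
  have : Nonempty (Fin d) := Fin.pos_iff_nonempty.1 hd
  exact ⟨hh.exists_isBackwardInvariant, hc.exists_isStationarySolution hh⟩

theorem proposition2p8 (d : ℕ) (hd : 1 ≤ d)
    (c : Fin d → (Fin d → ℝ) → (Fin d → ℝ) → ℝ)
    (hc : MeanFieldGame.IsRunningCost c) (hh : MeanFieldGame.IsContractive c) :
    (∃ M₀ : ℝ, ∀ M : ℝ, M₀ ≤ M →
      MeanFieldGame.IsBackwardInvariant c
        ({u : Fin d → ℝ | MeanFieldGame.sharpNorm u < M} ×ˢ stdSimplex ℝ (Fin d))) ∧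
    (∃ (θ u : Fin d → ℝ) (κ : ℝ), MeanFieldGame.IsStationarySolution c θ u κ) :=
  proposition2p8_general d hd c hc.isUniformlyConvexCost hh
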